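/- Let $n>2$ and let $\mathbf{s}: d_1\le d_2\le\dots\le d_n$ be a tree degree sequence, that is, a nondecreasing sequence of positive integers with $\sum_{i=1}^n d_i=2n-2$. Let $\mathcal{T}_{\mathbf{s}}$ be the set of all trees (equivalently, connected simple graphs) on $n$ labeled vertices whose degree sequence is $\mathbf{s}$. Let $l$ be the number of entries of $\mathbf{s}$ equal to $1$, and let the annihilation number $a(\mathbf{s})$ be the largest index $a\le n$ such that $\sum_{i=1}^{a} d_i\le n-1$. For a graph $G$ write $\nu(G)$ for its matching number, $\mathrm{null}(G)$ for the nullity of its adjacency matrix (the multiplicity of the eigenvalue $0$), and $\alpha(G)$ for its independence number. Then $\mathcal{T}_{\mathbf{s}}$ is non-empty, and each of the three equalities $$\min_{T\in\mathcal{T}_{\mathbf{s}}}\nu(T)=\max_{T\in\mathcal{T}_{\mathbf{s}}}\nu(T),\qquad \min_{T\in\mathcal{T}_{\mathbf{s}}}\mathrm{null}(T)=\max_{T\in\mathcal{T}_{\mathbf{s}}}\mathrm{null}(T),\qquad \min_{T\in\mathcal{T}_{\mathbf{s}}}\alpha(T)=\max_{T\in\mathcal{T}_{\mathbf{s}}}\alpha(T)$$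 holds if and only if $a(\mathbf{s})=l$ or $a(\mathbf{s})=\lceil n/2\rceil$. -/

import Mathlib

/-- A tree degree sequence `d₁ ≤ d₂ ≤ … ≤ dₙ` of length `n`: a nondecreasing sequence of positive
integers whose sum is `2 n - 2`. -/
structure IsTreeDegreeSequence {n : ℕ} (s : Fin n → ℕ) : Prop where
  monotone : Monotone s
  pos : ∀ i, 0 < s i
  sum_eq : ∑ i, s i + 2 = 2 * n

/-- The simple graph `G` on `n` labeled vertices has degree sequence `s`: the multiset of its vertex
degrees is the multiset of the entries of `s`. -/
def HasDegreeSequence {n : ℕ} (G : SimpleGraph (Fin n)) (s : Fin n → ℕ) : Prop :=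
  (Finset.univ : Finset (Fin n)).val.map (fun v => (G.neighborSet v).ncard) =
    (Finset.univ : Finset (Fin n)).val.map s

/-- The set `𝒯ₛ` of all connected graphs with degree sequence `s`. When `s` is a tree degree
sequence, these are exactly the trees with degree sequence `s`. -/
def treesWithDegreeSequence {n : ℕ} (s : Fin n → ℕ) : Set (SimpleGraph (Fin n)) :=
  {G | G.Connected ∧ HasDegreeSequence G s}

/-- The matching number `ν(G)`: the largest number of edges of a matching in `G`. -/
noncomputable def matchingNumber {n : ℕ} (G : SimpleGraph (Fin n)) : ℕ :=
  sSup {k | ∃ M : G.Subgraph, M.IsMatching ∧ M.edgeSet.ncard = k}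

open Classical in
/-- The nullity of `G`: the dimension of the kernel of its real adjacency matrix (which is the
multiplicity of the eigenvalue `0`, as the matrix is symmetric). -/
noncomputable def graphNullity {n : ℕ} (G : SimpleGraph (Fin n)) : ℕ :=
  Module.finrank ℝ (LinearMap.ker (Matrix.toLin' (G.adjMatrix ℝ)))

/-- The minimum of a graph parameter `f` over the trees with degree sequence `s`. -/
noncomputable def minOverTrees {n : ℕ} (f : SimpleGraph (Fin n) → ℕ) (s : Fin n → ℕ) : ℕ :=
  sInf (f '' treesWithDegreeSequence s)

/-- The maximum of a graph parameter `f` over the trees with degree sequence `s` (there are only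
finitely many graphs on `Fin n`, so the supremum is over a finite set). -/
noncomputable def maxOverTrees {n : ℕ} (f : SimpleGraph (Fin n) → ℕ) (s : Fin n → ℕ) : ℕ :=
  sSup (f '' treesWithDegreeSequence s)

/-- The number `l` of leaves of `s`, that is, of entries equal to `1`. -/
def leafCount {n : ℕ} (s : Fin n → ℕ) : ℕ :=
  (Finset.univ.filter (fun i => s i = 1)).card

/-- The annihilation number `a(s)`: the largest `k ≤ n` such that the sum of the first `k` terms of
the nondecreasing sequence `s` is at most the number of edges `m = (∑ dᵢ) / 2`. -/
def annihilationNumber {n : ℕ} (s : Fin n → ℕ) : ℕ :=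
  Nat.findGreatest
    (fun k => ∑ i ∈ Finset.univ.filter (fun i : Fin n => (i : ℕ) < k), s i ≤ (∑ i, s i) / 2) n

/-! For a tree, ν + α = n and null + 2ν = n (`SimpleGraph.IsTree.parameters_eq`), so each parameter
is constant over the trees in question exactly when α is. Every such tree satisfies max(l, ⌈n/2⌉) ≤
α ≤ a: for n > 2 the leaves are independent, null ≥ 0 gives 2α ≥ n, and the degrees over an
independent set sum to at most the number of edges. Both ends are attained.
`IsTreeDegreeOn.exists_isIndepSet` makes the a vertices of smallest degree independent, and
`IsTreeDegreeOn.exists_hasMatchingOfCard` gives a tree with a matching of min(n - l, ⌊n/2⌋) edges,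
hence with α ≤ max(l, ⌈n/2⌉). Both build the tree by induction, attaching a leaf to a tree on fewer
vertices. So α is constant iff a = max(l, ⌈n/2⌉). Since a is never below this maximum, that means a
= l or a = ⌈n/2⌉. -/

/-! ### Matchings and leaf stripping in trees -/

/-- `S` contains the vertices of a matching of `G` with `k` edges. -/
def HasMatchingOfCard {V : Type*} (G : SimpleGraph V) (S : Set V) (k : ℕ) : Prop :=
  ∃ M : G.Subgraph, M.IsMatching ∧ M.verts ⊆ S ∧ M.edgeSet.ncard = k

theorem hasMatchingOfCard_zero {V : Type*} (G : SimpleGraph V) (S : Set V) :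
    HasMatchingOfCard G S 0 :=
  ⟨⊥, fun v hv => hv.elim, by simp, by simp⟩

theorem HasMatchingOfCard.mono {V : Type*} {G H : SimpleGraph V} {S T : Set V} {k : ℕ}
    (h : HasMatchingOfCard G S k) (hGH : G ≤ H) (hST : S ⊆ T) : HasMatchingOfCard H T k := by
  obtain ⟨M, hM, hS, hk⟩ := h
  refine ⟨M.map (SimpleGraph.Hom.ofLE hGH), hM.map_ofLE hGH, ?_, ?_⟩
  · simpa using hS.trans hST
  · rw [← hk, SimpleGraph.Subgraph.edgeSet_map]
    congr 1
    simp

theorem HasMatchingOfCard.insert_edge {V : Type*} [Finite V] {G : SimpleGraph V} {S : Set V}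
    {k : ℕ} (h : HasMatchingOfCard G S k) {u v : V} (huv : G.Adj u v) (hu : u ∉ S) (hv : v ∉ S) :
    HasMatchingOfCard G (insert u (insert v S)) (k + 1) := by
  obtain ⟨M, hM, hS, hk⟩ := h
  have hd : Disjoint M.verts {u, v} := by
    rw [Set.disjoint_left]
    rintro x hx (rfl | rfl)
    · exact hu (hS hx)
    · exact hv (hS hx)
  refine ⟨M ⊔ G.subgraphOfAdj huv, hM.sup (SimpleGraph.Subgraph.IsMatching.subgraphOfAdj huv) ?_,
    ?_, ?_⟩
  · rw [hM.support_eq_verts, (SimpleGraph.Subgraph.IsMatching.subgraphOfAdj huv).support_eq_verts]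
    exact hd
  · intro x hx
    rcases hx with hx | hx
    · exact Or.inr (Or.inr (hS hx))
    · rcases hx with rfl | rfl
      · exact Or.inl rfl
      · exact Or.inr (Or.inl rfl)
  · have hnot : s(u, v) ∉ M.edgeSet := fun h => hu (hS (M.edge_vert h))
    rw [SimpleGraph.Subgraph.edgeSet_sup, SimpleGraph.edgeSet_subgraphOfAdj, Set.union_singleton,
      Set.ncard_insert_of_notMem hnot (Set.toFinite _), hk]

/-- A vertex set of a tree that spans an edge contains a vertex with exactly one neighbour in it. -/
theorem SimpleGraph.IsTree.exists_unique_adj_mem {V : Type*} {G : SimpleGraph V}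
    (hG : G.IsTree) (S : Finset V) {x y : V} (hx : x ∈ S) (hy : y ∈ S) (hxy : G.Adj x y) :
    ∃ v ∈ S, ∃ u ∈ S, G.Adj v u ∧ ∀ w ∈ S, G.Adj v w → w = u := by
  classical
  -- Take v farthest from x among the vertices with a neighbour in S. Its neighbours in S are
  -- candidates too, hence strictly closer to x, so each is the penultimate vertex of the unique
  -- path from x to v.
  obtain ⟨v, hv, hmax⟩ := (S.filter fun v => ∃ u ∈ S, G.Adj v u).exists_max_image (G.dist x)
    ⟨x, by simpa using ⟨hx, y, hy, hxy⟩⟩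
  obtain ⟨hvS, u, huS, hvu⟩ := Finset.mem_filter.1 hv
  have closer : ∀ w ∈ S, G.Adj v w → ∃ p : G.Walk x v, p.IsPath ∧ w = p.penultimate := by
    intro w hw hvw
    have h1 := hmax w (Finset.mem_filter.2 ⟨hw, v, hvS, hvw.symm⟩)
    have h2 := hG.dist_eq_dist_add_one_of_adj x hvw
    obtain ⟨q, hq⟩ := hG.connected.exists_walk_length_eq_dist x w
    refine ⟨q.concat hvw.symm, ?_, by simp⟩
    apply SimpleGraph.Walk.isPath_of_length_eq_dist
    rw [SimpleGraph.Walk.length_concat]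
    omega
  refine ⟨v, hvS, u, huS, hvu, fun w hw hvw => ?_⟩
  obtain ⟨p, hp, rfl⟩ := closer w hw hvw
  obtain ⟨q, hq, rfl⟩ := closer u huS hvu
  obtain ⟨r, -, hr⟩ := hG.existsUnique_path x v
  rw [hr p hp, hr q hq]

/-- Repeatedly stripping a leaf together with its neighbour from a vertex set `S` of a tree yields
an independent set, a matching and a set of free coordinates for the kernel of the adjacency
operator on `S`. -/
theorem SimpleGraph.IsTree.exists_indepSet_matching_kernel {V : Type*} [Fintype V] [DecidableEq V]
    {G : SimpleGraph V} [DecidableRel G.Adj] (hG : G.IsTree) (S : Finset V) :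
    ∃ (I D : Finset V) (k : ℕ), I ⊆ S ∧ G.IsIndepSet (I : Set V) ∧
      HasMatchingOfCard G (S : Set V) k ∧ I.card + k = S.card ∧ D.card + k = I.card ∧
      ∀ x : V → ℝ, (∀ v, v ∉ S → x v = 0) →
        (∀ v ∈ S, ∑ u ∈ G.neighborFinset v, x u = 0) → (∀ v ∈ D, x v = 0) → x = 0 := by
  induction S using Finset.strongInduction with
  | H S ih =>
  by_cases hS : ∃ x ∈ S, ∃ y ∈ S, G.Adj x y
  · obtain ⟨x, hx, y, hy, hxy⟩ := hS
    obtain ⟨v, hv, u, hu, hvu, huniq⟩ := hG.exists_unique_adj_mem S hx hy hxy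
    have hne : v ≠ u := hvu.ne
    have hsub : (S.erase v).erase u ⊂ S :=
      (Finset.erase_subset _ _).trans_ssubset (Finset.erase_ssubset hv)
    obtain ⟨I, D, k, hIS, hI, hM, hcard, hD, hker⟩ := ih _ hsub
    have hvI : v ∉ I := fun h => by simpa using hIS h
    have huI : u ∉ I := fun h => by simpa using hIS h
    have huE : u ∈ S.erase v := Finset.mem_erase.2 ⟨hne.symm, hu⟩
    have hcS : ((S.erase v).erase u).card + 2 = S.card := by
      have h1 := Finset.card_erase_add_one huE
      have h2 := Finset.card_erase_add_one hv
      omega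
    refine ⟨insert v I, D, k + 1, ?_, ?_, ?_, ?_, ?_, ?_⟩
    · intro w hw
      rcases Finset.mem_insert.1 hw with rfl | hw
      · exact hv
      · exact hsub.1 (hIS hw)
    · have key : ∀ w ∈ I, ¬ G.Adj v w := fun w hw hvw =>
        huI (huniq w (hsub.1 (hIS hw)) hvw ▸ hw)
      rw [Finset.coe_insert]
      exact Set.Pairwise.insert hI fun b hb _ => ⟨key b hb, fun h => key b hb h.symm⟩
    · refine (hM.insert_edge hvu (by simp) (by simp)).mono le_rfl ?_
      intro w hw
      rcases hw with rfl | rfl | hw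
      · exact hv
      · exact hu
      · exact hsub.1 hw
    · rw [Finset.card_insert_of_notMem hvI]; omega
    · rw [Finset.card_insert_of_notMem hvI]; omega
    · intro x hx0 hxS hxD
      -- Since u is the only neighbour of v in S, the kernel equation at v reads x u = 0.
      have hxu : x u = 0 := by
        rw [← hxS v hv]
        refine (Finset.sum_eq_single u (fun w hw hwu => ?_) fun h => ?_).symm
        · by_contra h0
          refine hwu (huniq w ?_ (by simpa using hw))
          by_contra hwS
          exact h0 (hx0 w hwS)
        · exact absurd (by simpa using hvu) h
      -- Zeroing the coordinate at v leaves the equations at the other vertices of S except u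
      -- unchanged, because none of these is adjacent to v. Induction then applies to z.
      set z : V → ℝ := Function.update x v 0 with hz
      have hzx : ∀ w, w ≠ v → z w = x w := fun w hw => Function.update_of_ne hw _ _
      have hzv : z v = 0 := Function.update_self _ _ _
      have hz0 : z = 0 := by
        apply hker
        · intro w hw
          by_cases hwv : w = v
          · rw [hwv, hzv]
          · rw [hzx w hwv]
            by_cases hwu : w = u
            · rw [hwu, hxu]
            · exact hx0 w fun h => hw (by simp [hwv, hwu, h])
        · intro w hw
          simp only [Finset.mem_erase] at hw
          rw [← hxS w hw.2.2]
          refine Finset.sum_congr rfl fun t ht => hzx t ?_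
          rintro rfl
          exact hw.1 (huniq w hw.2.2 (by simpa using ht : G.Adj w t).symm)
        · intro w hw
          by_cases hwv : w = v
          · rw [hwv, hzv]
          · rw [hzx w hwv, hxD w hw]
      have hxw : ∀ w, w ≠ v → x w = 0 := fun w hw => by rw [← hzx w hw, hz0]; rfl
      -- With all other coordinates zero, the equation at u leaves only x v.
      have hxv : x v = 0 := by
        rw [← hxS u hu]
        refine (Finset.sum_eq_single v (fun w _ hw => hxw w hw) fun h => ?_).symm
        exact absurd (by simpa using hvu.symm) h
      funext w
      by_cases hw : w = v
      · rw [hw, hxv]; rfl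
      · exact hxw w hw
  · push Not at hS
    refine ⟨S, S, 0, subset_rfl, fun x hx y hy _ => hS x hx y hy, hasMatchingOfCard_zero _ _, rfl,
      rfl, fun x hx0 _ hxD => ?_⟩
    funext v
    by_cases hv : v ∈ S
    · exact hxD v hv
    · exact hx0 v hv

/-! ### Matching number, nullity and independence number of a tree -/

theorem bddAbove_matching_card {n : ℕ} (G : SimpleGraph (Fin n)) :
    BddAbove {k | ∃ M : G.Subgraph, M.IsMatching ∧ M.edgeSet.ncard = k} := by
  refine ⟨Nat.card (Sym2 (Fin n)), ?_⟩
  rintro k ⟨M, -, rfl⟩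
  exact Set.ncard_le_card _

theorem HasMatchingOfCard.le_matchingNumber {n : ℕ} {G : SimpleGraph (Fin n)} {S : Set (Fin n)}
    {k : ℕ} (h : HasMatchingOfCard G S k) : k ≤ matchingNumber G := by
  obtain ⟨M, hM, -, hk⟩ := h
  exact le_csSup (bddAbove_matching_card G) ⟨M, hM, hk⟩

theorem exists_isMatching_matchingNumber {n : ℕ} (G : SimpleGraph (Fin n)) :
    ∃ M : G.Subgraph, M.IsMatching ∧ M.edgeSet.ncard = matchingNumber G := by
  refine Nat.sSup_mem ?_ (bddAbove_matching_card G)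
  obtain ⟨M, hM, -, hk⟩ := hasMatchingOfCard_zero G Set.univ
  exact ⟨0, M, hM, hk⟩

/-- Each edge of a matching has an endpoint outside I, and distinct edges give distinct endpoints.
-/
theorem matchingNumber_add_card_le {n : ℕ} {G : SimpleGraph (Fin n)} {I : Finset (Fin n)}
    (hI : G.IsIndepSet (I : Set (Fin n))) : matchingNumber G + I.card ≤ n := by
  obtain ⟨M, hM, hk⟩ := exists_isMatching_matchingNumber G
  have hex : ∀ e ∈ M.edgeSet, ∃ v, v ∈ e ∧ v ∉ I := by
    intro e
    induction e with
    | h a b =>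
      intro he
      have hab : M.Adj a b := he
      by_cases ha : a ∈ I
      · exact ⟨b, by simp, fun hb => hI ha hb hab.ne hab.adj_sub⟩
      · exact ⟨a, by simp, ha⟩
  rcases isEmpty_or_nonempty (Fin n) with hn | hn
  · rw [Set.eq_empty_of_isEmpty M.edgeSet, Set.ncard_empty] at hk
    rw [← hk, zero_add]
    exact (Finset.card_le_univ I).trans (Fintype.card_fin n).le
  choose! f hfe hfI using hex
  have hinj : Set.InjOn f M.edgeSet := by
    intro e he e' he' hee
    have h1 := hfe e he
    have h2 := hfe e' he'
    rw [← hee] at h2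
    obtain ⟨a, ha⟩ := h1
    obtain ⟨b, hb⟩ := h2
    rw [hb] at he'
    rw [ha] at he
    have hab : a = b := hM.eq_of_adj_left (show M.Adj _ a from he) (show M.Adj _ b from he')
    exact ha.trans ((congrArg _ hab).trans hb.symm)
  have hle : M.edgeSet.ncard ≤ ((Iᶜ : Finset (Fin n)) : Set (Fin n)).ncard :=
    Set.ncard_le_ncard_of_injOn f (fun e he => by simpa using hfI e he) hinj
  rw [Set.ncard_coe_finset, Finset.card_compl, Fintype.card_fin] at hle
  have := Finset.card_le_univ I
  rw [Fintype.card_fin] at this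
  omega

/-- If x vanishes outside I, then A x vanishes on I automatically. Requiring x and A x to vanish
outside I is therefore 2(n - |I|) linear conditions that already put x in the kernel. -/
theorem two_mul_card_le_card_add_graphNullity {n : ℕ} {G : SimpleGraph (Fin n)}
    {I : Finset (Fin n)} (hI : G.IsIndepSet (I : Set (Fin n))) :
    2 * I.card ≤ n + graphNullity G := by
  classical
  unfold graphNullity
  set A := Matrix.toLin' (G.adjMatrix ℝ)
  let r : (Fin n → ℝ) →ₗ[ℝ] ((Iᶜ : Finset (Fin n)) → ℝ) := LinearMap.funLeft ℝ ℝ Subtype.val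
  let Φ := r.prod (r.comp A)
  have hker : LinearMap.ker Φ ≤ LinearMap.ker A := by
    intro x hx
    have hx' : r x = 0 ∧ r (A x) = 0 := by
      simpa [Φ, LinearMap.mem_ker] using hx
    have h1 : ∀ v, v ∉ I → x v = 0 := fun v hv =>
      congrFun hx'.1 ⟨v, by simpa using hv⟩
    have h2 : ∀ v, v ∉ I → A x v = 0 := fun v hv =>
      congrFun hx'.2 ⟨v, by simpa using hv⟩
    rw [LinearMap.mem_ker]
    funext v
    by_cases hv : v ∈ I
    · rw [Matrix.toLin'_apply, SimpleGraph.adjMatrix_mulVec_apply]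
      refine Finset.sum_eq_zero fun u hu => h1 u fun huI => ?_
      have hvu : G.Adj v u := by simpa using hu
      exact hI hv huI hvu.ne hvu
    · exact h2 v hv
  have h1 := Submodule.finrank_mono hker
  have h2 := Φ.finrank_range_add_finrank_ker
  have h3 := Submodule.finrank_le (LinearMap.range Φ)
  have hc : (Iᶜ : Finset (Fin n)).card = n - I.card := by
    rw [Finset.card_compl, Fintype.card_fin]
  simp only [Module.finrank_prod, Module.finrank_fintype_fun_eq_card, Fintype.card_coe, hc,
    Fintype.card_fin] at h2 h3
  have := Finset.card_le_univ I
  rw [Fintype.card_fin] at this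
  omega

/-- For trees, `ν + α = n` and `null + 2 ν = n`. -/
theorem SimpleGraph.IsTree.parameters_eq {n : ℕ} {G : SimpleGraph (Fin n)} (hG : G.IsTree) :
    matchingNumber G + G.indepNum = n ∧ graphNullity G + 2 * matchingNumber G = n := by
  classical
  obtain ⟨I, D, k, -, hI, hM, hcard, hD, hker⟩ := hG.exists_indepSet_matching_kernel Finset.univ
  rw [Finset.card_univ, Fintype.card_fin] at hcard
  have h1 := hI.card_le_indepNum
  have h2 := hM.le_matchingNumber
  obtain ⟨J, hJ⟩ := G.exists_isNIndepSet_indepNum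
  have h3 := matchingNumber_add_card_le hJ.isIndepSet
  rw [hJ.card_eq] at h3
  have h4 := two_mul_card_le_card_add_graphNullity hI
  have h5 : graphNullity G ≤ D.card := by
    unfold graphNullity
    let r : LinearMap.ker (Matrix.toLin' (G.adjMatrix ℝ)) →ₗ[ℝ] (D → ℝ) :=
      (LinearMap.funLeft ℝ ℝ (Subtype.val : D → Fin n)).comp (Submodule.subtype _)
    have hr : Function.Injective r := by
      rw [← LinearMap.ker_eq_bot, LinearMap.ker_eq_bot']
      rintro ⟨x, hx⟩ hrx
      have hx0 : x = 0 := by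
        refine hker x (fun v hv => absurd (Finset.mem_univ v) hv) (fun v _ => ?_) fun v hv =>
          congrFun hrx ⟨v, hv⟩
        rw [← SimpleGraph.adjMatrix_mulVec_apply, ← Matrix.toLin'_apply]
        exact congrFun (LinearMap.mem_ker.1 hx) v
      exact Subtype.ext hx0
    have := LinearMap.finrank_le_finrank_of_injective hr
    rw [Module.finrank_fintype_fun_eq_card, Fintype.card_coe] at this
    convert this
  -- From |I| ≤ α ≤ n - ν ≤ n - k = |I| all are equalities, and |D| = 2|I| - n is both a lower and
  -- an upper bound for the nullity.
  omega

/-! ### Building trees with prescribed degrees -/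

/-- `G` is a graph on the vertex set `S`, connected on `S`, whose degrees on `S` are given by `d`. -/
structure IsConnectedOn {V : Type*} (G : SimpleGraph V) (S : Finset V) (d : V → ℕ) : Prop where
  adj_mem : ∀ x y, G.Adj x y → x ∈ S
  reachable : ∀ x ∈ S, ∀ y ∈ S, G.Reachable x y
  degree : ∀ x ∈ S, (G.neighborSet x).ncard = d x

/-- The values of `d` on `S` are the degrees of some tree. -/
structure IsTreeDegreeOn {V : Type*} (S : Finset V) (d : V → ℕ) : Prop where
  pos : ∀ x ∈ S, 0 < d x
  sum_eq : ∑ x ∈ S, d x + 2 = 2 * S.card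

theorem IsTreeDegreeOn.exists_eq_one {V : Type*} {S : Finset V} {d : V → ℕ}
    (h : IsTreeDegreeOn S d) : ∃ v ∈ S, d v = 1 := by
  by_contra! hne
  have : ∑ x ∈ S, 2 ≤ ∑ x ∈ S, d x := Finset.sum_le_sum fun x hx => by
    have := h.pos x hx
    have := hne x hx
    omega
  rw [Finset.sum_const, smul_eq_mul] at this
  have := h.sum_eq
  omega

theorem IsTreeDegreeOn.exists_two_le {V : Type*} {S : Finset V} {d : V → ℕ}
    (h : IsTreeDegreeOn S d) (hS : 3 ≤ S.card) :
    ∃ u ∈ S, 2 ≤ d u := by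
  by_contra! hne
  have : ∑ x ∈ S, d x ≤ ∑ x ∈ S, 1 := Finset.sum_le_sum fun x hx => by
    have := hne x hx
    omega
  rw [Finset.sum_const, smul_eq_mul] at this
  have := h.sum_eq
  omega

section

variable {V : Type*} [DecidableEq V] {S : Finset V} {d : V → ℕ} {u v : V}

/-- Attaching a new leaf. -/
theorem IsConnectedOn.sup_edge [Finite V] {G : SimpleGraph V} (hv : v ∈ S) (hu : u ∈ S)
    (hdv : d v = 1) (hdu : 2 ≤ d u)
    (h : IsConnectedOn G (S.erase v) (Function.update d u (d u - 1))) :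
    IsConnectedOn (G ⊔ SimpleGraph.edge u v) S d := by
  have hne : u ≠ v := by rintro rfl; omega
  have hGv : ∀ x, ¬ G.Adj v x := fun x hx => by simpa using h.adj_mem _ _ hx
  have huS : u ∈ S.erase v := Finset.mem_erase.2 ⟨hne, hu⟩
  have huv : (G ⊔ SimpleGraph.edge u v).Adj u v := by
    simp [SimpleGraph.edge_adj, hne]
  have hru : ∀ x ∈ S, (G ⊔ SimpleGraph.edge u v).Reachable x u := by
    intro x hx
    by_cases hxv : x = v
    · rw [hxv]; exact huv.symm.reachable
    · exact (h.reachable x (Finset.mem_erase.2 ⟨hxv, hx⟩) u huS).mono le_sup_left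
  refine ⟨fun x y hxy => ?_, fun x hx y hy => (hru x hx).trans (hru y hy).symm, fun x hx => ?_⟩
  · rw [SimpleGraph.sup_adj, SimpleGraph.edge_adj] at hxy
    rcases hxy with hxy | ⟨⟨rfl, -⟩ | ⟨rfl, -⟩, -⟩
    · exact Finset.mem_of_mem_erase (h.adj_mem _ _ hxy)
    · exact hu
    · exact hv
  · by_cases hxv : x = v
    · subst hxv
      have : (G ⊔ SimpleGraph.edge u x).neighborSet x = {u} := by
        ext y
        simp only [SimpleGraph.mem_neighborSet, SimpleGraph.sup_adj, SimpleGraph.edge_adj,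
          hGv y, Set.mem_singleton_iff]
        grind
      rw [this, Set.ncard_singleton, hdv]
    · have hd := h.degree x (Finset.mem_erase.2 ⟨hxv, hx⟩)
      by_cases hxu : x = u
      · subst hxu
        have : (G ⊔ SimpleGraph.edge x v).neighborSet x = insert v (G.neighborSet x) := by
          ext y
          simp only [SimpleGraph.mem_neighborSet, SimpleGraph.sup_adj, SimpleGraph.edge_adj,
            Set.mem_insert_iff]
          grind
        rw [this, Set.ncard_insert_of_notMem (fun h => hGv x h.symm) (Set.toFinite _), hd,
          Function.update_self]
        omega
      · have : (G ⊔ SimpleGraph.edge u v).neighborSet x = G.neighborSet x := by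
          ext y
          simp only [SimpleGraph.mem_neighborSet, SimpleGraph.sup_adj, SimpleGraph.edge_adj]
          grind
        rw [this, hd, Function.update_of_ne hxu]

/-- Deleting a leaf v attached to u costs the degree sum over A one unit for each of u, v in A. It
serves both for the whole vertex set and for the prospective independent set. -/
theorem sum_erase_update (A : Finset V) (hne : u ≠ v) (hdu : 1 ≤ d u) (hdv : d v = 1) :
    ∑ x ∈ A.erase v, Function.update d u (d u - 1) x + (if u ∈ A then 1 else 0) +
      (if v ∈ A then 1 else 0) = ∑ x ∈ A, d x := by
  have h1 : ∑ x ∈ A.erase v, Function.update d u (d u - 1) x + (if u ∈ A then 1 else 0) =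
      ∑ x ∈ A.erase v, d x := by
    by_cases hu : u ∈ A
    · have hu' : u ∈ A.erase v := Finset.mem_erase.2 ⟨hne, hu⟩
      rw [if_pos hu, Finset.sum_update_of_mem hu', Finset.sdiff_singleton_eq_erase,
        ← Finset.add_sum_erase _ d hu']
      omega
    · rw [if_neg hu, Finset.sum_update_of_notMem (fun h => hu (Finset.mem_of_mem_erase h)), add_zero]
  rw [h1]
  by_cases hv : v ∈ A
  · rw [if_pos hv, ← hdv, Finset.sum_erase_add _ _ hv]
  · rw [if_neg hv, Finset.erase_eq_of_notMem hv, add_zero]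

theorem IsTreeDegreeOn.erase (h : IsTreeDegreeOn S d) (hv : v ∈ S) (hu : u ∈ S) (hdv : d v = 1)
    (hdu : 2 ≤ d u) : IsTreeDegreeOn (S.erase v) (Function.update d u (d u - 1)) := by
  have hne : u ≠ v := by rintro rfl; omega
  refine ⟨fun x hx => ?_, ?_⟩
  · by_cases hxu : x = u
    · rw [hxu, Function.update_self]; omega
    · rw [Function.update_of_ne hxu]; exact h.pos x (Finset.mem_of_mem_erase hx)
  · have h1 := sum_erase_update S hne (by omega) hdv
    rw [if_pos hu, if_pos hv] at h1
    have h2 := Finset.card_erase_add_one hv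
    have h3 := h.sum_eq
    omega

/-- Deleting v loses one leaf, but u becomes a new one if its degree was 2. -/
theorem card_filter_update_le (hv : v ∈ S) (hdv : d v = 1) (hdu : 2 ≤ d u) :
    ((S.erase v).filter fun x => Function.update d u (d u - 1) x = 1).card + 1 ≤
      (S.filter fun x => d x = 1).card + if d u = 2 then 1 else 0 := by
  have hv' : v ∈ S.filter fun x => d x = 1 := Finset.mem_filter.2 ⟨hv, hdv⟩
  rw [← Finset.card_erase_add_one hv']
  by_cases h2 : d u = 2
  · rw [if_pos h2]
    have : ((S.erase v).filter fun x => Function.update d u (d u - 1) x = 1) ⊆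
        insert u ((S.filter fun x => d x = 1).erase v) := by
      intro x
      by_cases hxu : x = u
      · simp [hxu]
      · simp only [Finset.mem_filter, Finset.mem_erase, Finset.mem_insert,
          Function.update_of_ne hxu]
        tauto
    have := (Finset.card_le_card this).trans (Finset.card_insert_le _ _)
    omega
  · rw [if_neg h2]
    have : ((S.erase v).filter fun x => Function.update d u (d u - 1) x = 1) ⊆
        (S.filter fun x => d x = 1).erase v := by
      intro x
      by_cases hxu : x = u
      · simp only [Finset.mem_filter, hxu, Function.update_self]
        omega
      · simp only [Finset.mem_filter, Finset.mem_erase, Function.update_of_ne hxu]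
        tauto
    have := Finset.card_le_card this
    omega

theorem IsTreeDegreeOn.exists_isConnectedOn_of_card_eq_two [Finite V] (h : IsTreeDegreeOn S d)
    (hS : S.card = 2) : ∃ G, IsConnectedOn G S d ∧ HasMatchingOfCard G (S : Set V) 1 := by
  obtain ⟨a, b, hab, rfl⟩ := Finset.card_eq_two.1 hS
  have h1 := h.sum_eq
  have ha := h.pos a (by simp)
  have hb := h.pos b (by simp)
  rw [Finset.sum_pair hab, hS] at h1
  have hadj : ∀ x y, (SimpleGraph.edge a b).Adj x y ↔ x = a ∧ y = b ∨ x = b ∧ y = a := by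
    intro x y
    rw [SimpleGraph.edge_adj]
    grind
  have hadj1 : (SimpleGraph.edge a b).Adj a b := (hadj a b).2 (Or.inl ⟨rfl, rfl⟩)
  have hna : (SimpleGraph.edge a b).neighborSet a = {b} := by
    ext y; simp [hadj, hab]
  have hnb : (SimpleGraph.edge a b).neighborSet b = {a} := by
    ext y; simp [hadj, hab.symm]
  refine ⟨SimpleGraph.edge a b, ⟨fun x y hxy => ?_, fun x hx y hy => ?_, fun x hx => ?_⟩, ?_⟩
  · rcases (hadj x y).1 hxy with ⟨rfl, -⟩ | ⟨rfl, -⟩ <;> simp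
  · simp only [Finset.mem_insert, Finset.mem_singleton] at hx hy
    rcases hx with rfl | rfl <;> rcases hy with rfl | rfl
    · exact SimpleGraph.Reachable.refl _
    · exact hadj1.reachable
    · exact hadj1.symm.reachable
    · exact SimpleGraph.Reachable.refl _
  · simp only [Finset.mem_insert, Finset.mem_singleton] at hx
    rcases hx with rfl | rfl
    · rw [hna, Set.ncard_singleton]; omega
    · rw [hnb, Set.ncard_singleton]; omega
  · refine ((hasMatchingOfCard_zero _ ∅).insert_edge hadj1 (by simp) (by simp)).mono le_rfl ?_
    simp

/-- If the degrees in `A` add up to at most the number of edges, then some tree with the given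
degrees has `A` as an independent set. -/
theorem IsTreeDegreeOn.exists_isIndepSet [Finite V] (h : IsTreeDegreeOn S d) (hS : 2 ≤ S.card)
    {A : Finset V} (hA : A ⊆ S) (hsum : ∑ x ∈ A, d x + 1 ≤ S.card) :
    ∃ G, IsConnectedOn G S d ∧ G.IsIndepSet (A : Set V) := by
  induction hc : S.card using Nat.strong_induction_on generalizing S d A with
  | _ c ih =>
  have hcardA : A.card ≤ ∑ x ∈ A, d x := by
    rw [Finset.card_eq_sum_ones]
    exact Finset.sum_le_sum fun x hx => h.pos x (hA hx)
  rcases hS.eq_or_lt with h2 | h3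
  · obtain ⟨G, hG, -⟩ := h.exists_isConnectedOn_of_card_eq_two h2.symm
    refine ⟨G, hG, fun x hx y hy hxy => absurd ?_ hxy⟩
    exact Finset.card_le_one.1 (by omega) x hx y hy
  -- The new edge should have exactly one end in A, so that the sum over A drops along with |S|. A
  -- leaf in A is attached to an inner vertex outside A; if A has no leaf, a leaf outside is
  -- attached to a vertex of A, or to any inner vertex when A is empty.
  obtain ⟨v, hv, u, hu, hdv, hdu, huv, hsum'⟩ : ∃ v ∈ S, ∃ u ∈ S, d v = 1 ∧ 2 ≤ d u ∧
      ¬ (u ∈ A ∧ v ∈ A) ∧ ∑ x ∈ A.erase v, Function.update d u (d u - 1) x + 2 ≤ S.card := by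
    by_cases hleaf : ∃ v ∈ A, d v = 1
    · obtain ⟨v, hvA, hdv⟩ := hleaf
      -- If all vertices outside A were leaves, the sum over A would be |S| - 2 + |A|. The bound
      -- then forces A = {v} and |S| ≤ 2.
      have hex : ∃ u ∈ S \ A, 2 ≤ d u := by
        by_contra! hne
        have h1 : ∑ x ∈ S \ A, d x ≤ (S \ A).card := by
          rw [Finset.card_eq_sum_ones]
          exact Finset.sum_le_sum fun x hx => by have := hne x hx; omega
        have h2 := Finset.sum_sdiff (f := d) hA
        have h4 := h.sum_eq
        have h5 := Finset.card_sdiff_add_card_eq_card hA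
        have h6 : A.card = 1 := by
          have := Finset.card_pos.2 ⟨v, hvA⟩
          omega
        have h7 : ∑ x ∈ A, d x = 1 := by
          obtain ⟨w, rfl⟩ := Finset.card_eq_one.1 h6
          rw [Finset.mem_singleton] at hvA
          rw [Finset.sum_singleton, ← hvA, hdv]
        omega
      obtain ⟨u, hu, hdu⟩ := hex
      rw [Finset.mem_sdiff] at hu
      have hne : u ≠ v := by rintro rfl; omega
      have := sum_erase_update (d := d) A hne (by omega) hdv
      rw [if_neg hu.2, if_pos hvA] at this
      exact ⟨v, hA hvA, u, hu.1, hdv, hdu, fun h => hu.2 h.1, by omega⟩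
    · obtain ⟨v, hv, hdv⟩ := h.exists_eq_one
      have hvA : v ∉ A := fun hvA => hleaf ⟨v, hvA, hdv⟩
      rcases A.eq_empty_or_nonempty with rfl | ⟨u, huA⟩
      · obtain ⟨u, hu, hdu⟩ := h.exists_two_le h3
        exact ⟨v, hv, u, hu, hdv, hdu, by simp, by simpa using hS⟩
      · have hdu : 2 ≤ d u := by
          have := h.pos u (hA huA)
          have : d u ≠ 1 := fun h => hleaf ⟨u, huA, h⟩
          omega
        have hne : u ≠ v := by rintro rfl; omega
        have := sum_erase_update (d := d) A hne (by omega) hdv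
        rw [if_pos huA, if_neg hvA] at this
        exact ⟨v, hv, u, hA huA, hdv, hdu, fun h => hvA h.2, by omega⟩
  have hcard := Finset.card_erase_add_one hv
  obtain ⟨G, hG, hind⟩ := ih _ (by omega) (h.erase hv hu hdv hdu) (by omega)
    (Finset.erase_subset_erase v hA) (by omega) rfl
  refine ⟨_, hG.sup_edge hv hu hdv hdu, fun x hx y hy hxy hadj => ?_⟩
  rw [SimpleGraph.sup_adj, SimpleGraph.edge_adj] at hadj
  rcases hadj with hadj | ⟨⟨rfl, rfl⟩ | ⟨rfl, rfl⟩, -⟩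
  · refine hind ?_ ?_ hxy hadj
    · exact Finset.mem_erase.2 ⟨(Finset.mem_erase.1 (hG.adj_mem _ _ hadj)).1, hx⟩
    · exact Finset.mem_erase.2 ⟨(Finset.mem_erase.1 (hG.adj_mem _ _ hadj.symm)).1, hy⟩
  · exact huv ⟨hx, hy⟩
  · exact huv ⟨hy, hx⟩

/-- Some tree with the given degrees has a matching that covers all inner vertices or misses at
most one vertex. -/
theorem IsTreeDegreeOn.exists_hasMatchingOfCard [Finite V] (h : IsTreeDegreeOn S d)
    (hS : 2 ≤ S.card) {k : ℕ} (hk : 2 * k ≤ S.card)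
    (hkl : k + (S.filter fun x => d x = 1).card ≤ S.card ∨ k = 1) :
    ∃ G, IsConnectedOn G S d ∧ HasMatchingOfCard G (S : Set V) k := by
  induction hc : S.card using Nat.strong_induction_on generalizing S d k with
  | _ c ih =>
  rcases Nat.eq_zero_or_pos k with rfl | hkpos
  · obtain ⟨G, hG, -⟩ := h.exists_isIndepSet hS (Finset.empty_subset S)
      (by rw [Finset.sum_empty]; omega)
    exact ⟨G, hG, hasMatchingOfCard_zero _ _⟩
  -- A single edge has two leaves and k = 1, so k + l ≤ |S| fails; the alternative k = 1 covers it.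
  rcases hS.eq_or_lt with h2 | h3
  · obtain rfl : k = 1 := by omega
    exact h.exists_isConnectedOn_of_card_eq_two h2.symm
  obtain ⟨v, hv, hdv⟩ := h.exists_eq_one
  have hcv := Finset.card_erase_add_one hv
  -- Attach v to u and leave it unmatched. This needs a spare vertex, and a leaf count that really
  -- drops unless k = 1.
  have single : ∀ u ∈ S, 2 ≤ d u → 2 * k + 1 ≤ S.card → (3 ≤ d u ∨ k = 1) →
      ∃ G, IsConnectedOn G S d ∧ HasMatchingOfCard G (S : Set V) k := by
    intro u hu hdu hk' hor
    have hL := card_filter_update_le hv hdv hdu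
    obtain ⟨G, hG, hM⟩ := ih _ (by omega) (k := k) (h.erase hv hu hdv hdu) (by omega) (by omega)
      (by split_ifs at hL <;> omega) rfl
    exact ⟨_, hG.sup_edge hv hu hdv hdu, hM.mono le_sup_left (by simp)⟩
  -- Hang the path w, u, v from w and match u with v; the smaller tree must supply k - 1 edges. If w
  -- also has degree 2 it becomes a leaf, so the leaf count need not drop.
  have double : ∀ u ∈ S, ∀ w ∈ S, d u = 2 → w ≠ u → 2 ≤ d w → 4 ≤ S.card →
      (d w = 2 → k ≤ 2 ∨ k + (S.filter fun x => d x = 1).card + 1 ≤ S.card) →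
      ∃ G, IsConnectedOn G S d ∧ HasMatchingOfCard G (S : Set V) k := by
    intro u hu w hw hdu hwu hdw h4 hor
    have huv : u ≠ v := by rintro rfl; omega
    have hwv : w ≠ v := by rintro rfl; omega
    have hL := card_filter_update_le hv hdv hdu.ge
    have ht := h.erase hv hu hdv hdu.ge
    set d' := Function.update d u (d u - 1)
    have hd'u : d' u = 1 := by simp [d', hdu]
    have hd'w : d' w = d w := by simp [d', hwu]
    have hu' : u ∈ S.erase v := Finset.mem_erase.2 ⟨huv, hu⟩
    have hw' : w ∈ S.erase v := Finset.mem_erase.2 ⟨hwv, hw⟩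
    have hL' := card_filter_update_le (u := w) hu' hd'u (by omega)
    have ht' := ht.erase hu' hw' hd'u (by omega)
    have hcu := Finset.card_erase_add_one hu'
    have hLc := Finset.card_filter_le ((S.erase v).erase u)
      fun x => Function.update d' w (d' w - 1) x = 1
    rw [if_pos hdu] at hL
    obtain ⟨G, hG, hM⟩ := ih _ (by omega) (k := k - 1) ht' (by omega) (by omega)
      (by split_ifs at hL' <;> omega) rfl
    refine ⟨_, (hG.sup_edge hu' hw' hd'u (by omega)).sup_edge hv hu hdv hdu.ge, ?_⟩
    have := (hM.mono (le_sup_left.trans le_sup_left) subset_rfl).insert_edge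
      (G := (G ⊔ SimpleGraph.edge w u) ⊔ SimpleGraph.edge u v) (u := u) (v := v)
      (by simp [SimpleGraph.edge_adj, huv]) (by simp) (by simp)
    rw [Nat.sub_add_cancel hkpos] at this
    refine this.mono le_rfl ?_
    intro x hx
    rcases hx with rfl | rfl | hx
    · exact hu
    · exact hv
    · exact Finset.mem_of_mem_erase (Finset.mem_of_mem_erase hx)
  have hcount := Finset.card_filter_add_card_filter_not (s := S) fun x => d x = 1
  have hsplit := Finset.sum_filter_add_sum_filter_not S (fun x => d x = 1) d
  have hones : ∑ x ∈ S with d x = 1, d x = (S.filter fun x => d x = 1).card := by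
    rw [Finset.card_eq_sum_ones]
    exact Finset.sum_congr rfl fun x hx => (Finset.mem_filter.1 hx).2
  have hsum := h.sum_eq
  by_cases h2 : ∃ u ∈ S, d u = 2
  · obtain ⟨u, hu, hdu⟩ := h2
    by_cases hbig : ∃ w ∈ S, 3 ≤ d w
    · obtain ⟨w, hw, hdw⟩ := hbig
      have h4 : 4 ≤ S.card := by
        have hwu : w ≠ u := by rintro rfl; omega
        have : ∑ x ∈ ({w, u} : Finset V), (d x - 1) ≤ ∑ x ∈ S, (d x - 1) :=
          Finset.sum_le_sum_of_subset (by simp [Finset.insert_subset_iff, hw, hu])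
        rw [Finset.sum_pair hwu] at this
        have h6 : ∑ x ∈ S, (d x - 1) + S.card = ∑ x ∈ S, d x := by
          rw [Finset.card_eq_sum_ones, ← Finset.sum_add_distrib]
          exact Finset.sum_congr rfl fun x hx => Nat.sub_add_cancel (h.pos x hx)
        omega
      exact double u hu w hw hdu (by rintro rfl; omega) (by omega) h4 (by omega)
    -- All inner degrees are 2: the tree is a path, with l = 2.
    · push Not at hbig
      have htwo : ∀ x ∈ S.filter fun x => ¬ d x = 1, d x = 2 := by
        intro x hx
        rw [Finset.mem_filter] at hx
        have := h.pos x hx.1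
        have := hbig x hx.1
        omega
      rw [Finset.sum_congr rfl htwo, Finset.sum_const, smul_eq_mul] at hsplit
      rcases Nat.lt_or_ge S.card 4 with h4 | h4
      · exact single u hu hdu.ge (by omega) (by omega)
      · obtain ⟨w, hw, hwu⟩ := Finset.exists_mem_ne
          (s := S.filter fun x => ¬ d x = 1) (by omega) u
        have hdw := htwo w hw
        exact double u hu w (Finset.mem_filter.1 hw).1 hdu hwu hdw.ge h4 (by omega)
  · push Not at h2
    obtain ⟨u, hu, hdu⟩ := h.exists_two_le h3
    -- With all inner degrees at least 3, the degree sum gives 2l ≥ |S| + 2. So k ≤ |S| - l implies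
    -- 2k ≤ |S| - 2, and a vertex can stay unmatched.
    have hthree : ∑ x ∈ S with ¬ d x = 1, 3 ≤ ∑ x ∈ S with ¬ d x = 1, d x := by
      refine Finset.sum_le_sum fun x hx => ?_
      rw [Finset.mem_filter] at hx
      have := h.pos x hx.1
      have := h2 x hx.1
      omega
    rw [Finset.sum_const, smul_eq_mul] at hthree
    have := h2 u hu
    exact single u hu hdu (by omega) (by omega)

end

/-! ### Bounds on the independence number and their sharpness -/

theorem HasDegreeSequence.exists_perm {n : ℕ} {G : SimpleGraph (Fin n)} {s : Fin n → ℕ}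
    (h : HasDegreeSequence G s) :
    ∃ σ : Equiv.Perm (Fin n), ∀ v, (G.neighborSet v).ncard = s (σ v) := by
  have hfib : ∀ c, Nonempty ({v // (G.neighborSet v).ncard = c} ≃ {i // s i = c}) := by
    intro c
    refine ⟨Fintype.equivOfCardEq ?_⟩
    have := congrArg (Multiset.count c) h
    rw [Multiset.count_map, Multiset.count_map] at this
    rw [Fintype.card_subtype, Fintype.card_subtype]
    simp only [eq_comm (a := c)] at this
    exact this
  exact ⟨Equiv.ofFiberEquiv fun c => (hfib c).some,
    fun v => (Equiv.ofFiberEquiv_map (fun c => (hfib c).some) v).symm⟩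

theorem IsTreeDegreeSequence.isTree {n : ℕ} {G : SimpleGraph (Fin n)} {s : Fin n → ℕ}
    (hs : IsTreeDegreeSequence s) (hG : G ∈ treesWithDegreeSequence s) : G.IsTree := by
  classical
  refine SimpleGraph.isTree_iff_connected_and_card.2 ⟨hG.1, ?_⟩
  obtain ⟨σ, hσ⟩ := hG.2.exists_perm
  have h1 := G.sum_degrees_eq_twice_card_edges
  have h2 : ∑ v, G.degree v = ∑ i, s i := by
    rw [← Equiv.sum_comp σ s]
    refine Finset.sum_congr rfl fun v _ => ?_
    rw [← hσ, Set.ncard_eq_toFinset_card', ← SimpleGraph.card_neighborSet_eq_degree,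
      Set.toFinset_card]
  have h3 := hs.sum_eq
  rw [Nat.card_eq_fintype_card, ← SimpleGraph.edgeFinset_card, Nat.card_eq_fintype_card,
    Fintype.card_fin]
  omega

/-- Counting from 0, the j-th smallest element of J is at least j. -/
theorem Monotone.sum_initial_le_sum {n : ℕ} {s : Fin n → ℕ} (hs : Monotone s)
    (J : Finset (Fin n)) :
    ∑ i ∈ Finset.univ.filter (fun i : Fin n => (i : ℕ) < J.card), s i ≤ ∑ i ∈ J, s i := by
  have hJ : J.card ≤ n := by simpa using Finset.card_le_univ J
  have h1 : ∑ i ∈ Finset.univ.filter (fun i : Fin n => (i : ℕ) < J.card), s i =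
      ∑ j : Fin J.card, s (Fin.castLE hJ j) := by
    symm
    refine Finset.sum_bij (fun j _ => Fin.castLE hJ j) (fun j _ => by simp) ?_ ?_ fun _ _ => rfl
    · intro a _ b _ hab
      exact Fin.castLE_injective hJ hab
    · intro i hi
      exact ⟨⟨i, (Finset.mem_filter.1 hi).2⟩, Finset.mem_univ _, rfl⟩
  have h2 : ∑ i ∈ J, s i = ∑ j : Fin J.card, s (J.orderEmbOfFin rfl j) := by
    rw [← Finset.sum_coe_sort J, ← Equiv.sum_comp (J.orderIsoOfFin rfl).toEquiv]
    rfl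
  rw [h1, h2]
  refine Finset.sum_le_sum fun j _ => hs ?_
  have : ∀ m (hm : m < J.card), m ≤ (J.orderEmbOfFin rfl ⟨m, hm⟩ : ℕ) := by
    intro m
    induction m with
    | zero => exact fun _ => Nat.zero_le _
    | succ m ih =>
      intro hm
      have h3 := ih (by omega)
      have h4 : J.orderEmbOfFin rfl ⟨m, by omega⟩ < J.orderEmbOfFin rfl ⟨m + 1, hm⟩ :=
        (J.orderEmbOfFin rfl).strictMono (by simp)
      rw [Fin.lt_def] at h4
      omega
  exact this j j.2

/-- The degrees over an independent set add up to at most the number of edges. -/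
theorem two_mul_sum_degree_le_of_isIndepSet {V : Type*} [Fintype V] [DecidableEq V]
    {G : SimpleGraph V} [DecidableRel G.Adj] {I : Finset V} (hI : G.IsIndepSet (I : Set V)) :
    2 * ∑ v ∈ I, G.degree v ≤ ∑ v, G.degree v := by
  have hle : ∑ v ∈ I, G.degree v ≤ ∑ v ∈ Iᶜ, G.degree v := by
    have h1 : ∀ v ∈ I, G.degree v = ∑ u ∈ Iᶜ, if G.Adj v u then 1 else 0 := by
      intro v hv
      rw [← Finset.card_filter, ← SimpleGraph.card_neighborFinset_eq_degree]
      congr 1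
      ext u
      simp only [SimpleGraph.mem_neighborFinset, Finset.mem_filter, Finset.mem_compl]
      exact ⟨fun h => ⟨fun hu => hI hv hu h.ne h, h⟩, And.right⟩
    rw [Finset.sum_congr rfl h1, Finset.sum_comm]
    refine Finset.sum_le_sum fun u _ => ?_
    rw [← Finset.card_filter, ← SimpleGraph.card_neighborFinset_eq_degree]
    refine Finset.card_le_card fun v hv => ?_
    simpa using (Finset.mem_filter.1 hv).2.symm
  rw [← Finset.sum_add_sum_compl I]
  omega

theorem indepNum_le_annihilationNumber {n : ℕ} {G : SimpleGraph (Fin n)} {s : Fin n → ℕ}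
    (hs : IsTreeDegreeSequence s) (hG : HasDegreeSequence G s) :
    G.indepNum ≤ annihilationNumber s := by
  classical
  obtain ⟨I, hI⟩ := G.exists_isNIndepSet_indepNum
  obtain ⟨σ, hσ⟩ := hG.exists_perm
  have hdeg : ∀ v, G.degree v = s (σ v) := by
    intro v
    rw [← hσ, Set.ncard_eq_toFinset_card', ← SimpleGraph.card_neighborSet_eq_degree,
      Set.toFinset_card]
  have h1 := two_mul_sum_degree_le_of_isIndepSet hI.isIndepSet
  simp only [hdeg] at h1
  rw [Equiv.sum_comp σ s] at h1
  have h2 := hs.monotone.sum_initial_le_sum (I.map σ.toEmbedding)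
  rw [Finset.sum_map, Finset.card_map, hI.card_eq] at h2
  refine Nat.le_findGreatest ?_ ?_
  · rw [← hI.card_eq]
    simpa using Finset.card_le_univ I
  · refine h2.trans ((Nat.le_div_iff_mul_le two_pos).2 ?_)
    rw [mul_comm]
    exact h1

/-- Leaves are pairwise non-adjacent: two adjacent leaves would form a whole component, while n > 2.
-/
theorem leafCount_le_indepNum {n : ℕ} (hn : 2 < n) {G : SimpleGraph (Fin n)} {s : Fin n → ℕ}
    (hG : G ∈ treesWithDegreeSequence s) : leafCount s ≤ G.indepNum := by
  classical
  obtain ⟨σ, hσ⟩ := hG.2.exists_perm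
  have hcard : (Finset.univ.filter fun v => (G.neighborSet v).ncard = 1).card = leafCount s := by
    unfold leafCount
    simp only [hσ]
    rw [← Finset.card_map σ.toEmbedding]
    congr 1
    ext v
    simp only [Finset.mem_map, Finset.mem_filter, Finset.mem_univ, true_and]
    exact ⟨fun ⟨w, hw, h⟩ => h ▸ hw, fun h => ⟨σ.symm v, by simpa using h, by simp⟩⟩
  rw [← hcard]
  refine SimpleGraph.IsIndepSet.card_le_indepNum fun x hx y hy _ hxy => ?_
  simp only [Finset.coe_filter, Finset.mem_univ, true_and, Set.mem_ofPred_eq] at hx hy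
  rw [Set.ncard_eq_one] at hx hy
  obtain ⟨a, ha⟩ := hx
  obtain ⟨b, hb⟩ := hy
  have hxa : ∀ w, G.Adj x w → w = y := by
    have h1 : y = a := by simpa [ha] using (show y ∈ G.neighborSet x from hxy)
    intro w hw
    have h2 : w = a := by simpa [ha] using (show w ∈ G.neighborSet x from hw)
    rw [h1, h2]
  have hyb : ∀ w, G.Adj y w → w = x := by
    have h1 : x = b := by simpa [hb] using (show x ∈ G.neighborSet y from hxy.symm)
    intro w hw
    have h2 : w = b := by simpa [hb] using (show w ∈ G.neighborSet y from hw)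
    rw [h1, h2]
  obtain ⟨z, hz⟩ : ∃ z, z ∉ ({x, y} : Finset (Fin n)) := by
    by_contra! hall
    have := Finset.card_le_card (fun z _ => hall z : Finset.univ ⊆ ({x, y} : Finset (Fin n)))
    have := Finset.card_le_two (a := x) (b := y)
    simp only [Finset.card_univ, Fintype.card_fin] at *
    omega
  obtain ⟨p⟩ := hG.1.preconnected x z
  obtain ⟨e, -, he1, he2⟩ := p.exists_boundary_dart {x, y} (by simp) (by simpa using hz)
  rcases he1 with he1 | he1
  · exact he2 (Or.inr (hxa _ (he1 ▸ e.adj)))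
  · exact he2 (Or.inl (hyb _ (he1 ▸ e.adj)))

theorem IsTreeDegreeSequence.isTreeDegreeOn {n : ℕ} {s : Fin n → ℕ}
    (hs : IsTreeDegreeSequence s) : IsTreeDegreeOn Finset.univ s :=
  ⟨fun x _ => hs.pos x, by simpa using hs.sum_eq⟩

theorem IsConnectedOn.mem_treesWithDegreeSequence {n : ℕ} [NeZero n] {G : SimpleGraph (Fin n)}
    {s : Fin n → ℕ} (hG : IsConnectedOn G Finset.univ s) : G ∈ treesWithDegreeSequence s := by
  refine ⟨⟨fun x y => hG.reachable x (Finset.mem_univ _) y (Finset.mem_univ _)⟩, ?_⟩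
  exact Multiset.map_congr rfl fun v _ => hG.degree v (Finset.mem_univ _)

theorem exists_annihilationNumber_le_indepNum {n : ℕ} (hn : 2 < n) {s : Fin n → ℕ}
    (hs : IsTreeDegreeSequence s) :
    ∃ G ∈ treesWithDegreeSequence s, annihilationNumber s ≤ G.indepNum := by
  have : NeZero n := ⟨by omega⟩
  have hle : annihilationNumber s ≤ n := Nat.findGreatest_le n
  have hsum : ∑ i ∈ Finset.univ.filter (fun i : Fin n => (i : ℕ) < annihilationNumber s), s i ≤
      (∑ i, s i) / 2 :=
    Nat.findGreatest_spec (P := fun k => ∑ i ∈ Finset.univ.filter (fun i : Fin n => (i : ℕ) < k),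
      s i ≤ (∑ i, s i) / 2) (Nat.zero_le n) (by simp)
  have h2 := hs.sum_eq
  -- Half the degree sum is n - 1, so the first a(s) vertices satisfy the degree bound.
  obtain ⟨G, hG, hI⟩ := hs.isTreeDegreeOn.exists_isIndepSet (by simp; omega)
    (Finset.filter_subset (fun i : Fin n => (i : ℕ) < annihilationNumber s) _)
    (by rw [Finset.card_univ, Fintype.card_fin]; omega)
  refine ⟨G, hG.mem_treesWithDegreeSequence, le_trans ?_ hI.card_le_indepNum⟩
  rw [Fin.card_filter_val_lt]
  omega

theorem exists_indepNum_le_leafCount_or {n : ℕ} (hn : 2 < n) {s : Fin n → ℕ}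
    (hs : IsTreeDegreeSequence s) :
    ∃ G ∈ treesWithDegreeSequence s, G.indepNum ≤ leafCount s ∨ 2 * G.indepNum ≤ n + 1 := by
  have : NeZero n := ⟨by omega⟩
  have hl : leafCount s ≤ n := 
    (Finset.card_le_univ _).trans (Fintype.card_fin n).le
  -- This k is the complement of max(l, ⌈n/2⌉) in n, and α = n - ν ≤ n - k.
  obtain ⟨G, hG, hM⟩ := hs.isTreeDegreeOn.exists_hasMatchingOfCard 
    (k := min (n - leafCount s) (n / 2)) (by simp; omega) (by simp; omega) (Or.inl (by
      rw [Finset.card_univ, Fintype.card_fin]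
      change _ + leafCount s ≤ n
      omega))
  have hmem := hG.mem_treesWithDegreeSequence
  have h1 := (hs.isTree hmem).parameters_eq.1
  have h2 := hM.le_matchingNumber
  exact ⟨G, hmem, by omega⟩

/-! ### Constancy of the parameters -/

theorem minOverTrees_eq_maxOverTrees_iff {n : ℕ} {s : Fin n → ℕ} (f : SimpleGraph (Fin n) → ℕ)
    (h : (treesWithDegreeSequence s).Nonempty) :
    minOverTrees f s = maxOverTrees f s ↔
      ∀ G ∈ treesWithDegreeSequence s, ∀ H ∈ treesWithDegreeSequence s, f G = f H := by
  have hb : BddAbove (f '' treesWithDegreeSequence s) := (Set.toFinite _).bddAbove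
  have hlow : ∀ G ∈ treesWithDegreeSequence s, minOverTrees f s ≤ f G := fun G hG =>
    Nat.sInf_le ⟨G, hG, rfl⟩
  have hup : ∀ G ∈ treesWithDegreeSequence s, f G ≤ maxOverTrees f s := fun G hG =>
    le_csSup hb ⟨G, hG, rfl⟩
  refine ⟨fun heq G hG H hH => ?_, fun hall => ?_⟩
  · have := hlow G hG
    have := hlow H hH
    have := hup G hG
    have := hup H hH
    omega
  · obtain ⟨G, hG, hGmin⟩ := Nat.sInf_mem (h.image f)
    obtain ⟨H, hH, hHmax⟩ := Nat.sSup_mem (h.image f) hb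
    exact hGmin.symm.trans ((hall G hG H hH).trans hHmax)

theorem Nat.ceil_div_two_eq (n : ℕ) : ⌈(n : ℚ) / 2⌉₊ = (n + 1) / 2 := by
  refine eq_of_forall_ge_iff fun c => ?_
  rw [Nat.ceil_le, div_le_iff₀ two_pos]
  norm_cast
  omega

theorem indepNum_constant_iff {n : ℕ} (hn : 2 < n) {s : Fin n → ℕ}
    (hs : IsTreeDegreeSequence s) :
    (∀ G ∈ treesWithDegreeSequence s, ∀ H ∈ treesWithDegreeSequence s,
      G.indepNum = H.indepNum) ↔
      annihilationNumber s = leafCount s ∨ annihilationNumber s = ⌈(n : ℚ) / 2⌉₊ := by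
  rw [Nat.ceil_div_two_eq]
  have hbounds : ∀ G ∈ treesWithDegreeSequence s, leafCount s ≤ G.indepNum ∧
      n ≤ 2 * G.indepNum ∧ G.indepNum ≤ annihilationNumber s := by
    intro G hG
    -- Nullity n - 2ν is non-negative, and ν = n - α turns this into n ≤ 2α.
    have := (hs.isTree hG).parameters_eq
    exact ⟨leafCount_le_indepNum hn hG, by omega, indepNum_le_annihilationNumber hs hG.2⟩
  constructor
  · intro hall
    obtain ⟨G, hG, hGa⟩ := exists_annihilationNumber_le_indepNum hn hs
    obtain ⟨H, hH, hHa⟩ := exists_indepNum_le_leafCount_or hn hs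
    have := hall G hG H hH
    have := hbounds G hG
    omega
  · intro h G hG H hH
    have := hbounds G hG
    have := hbounds H hH
    omega

theorem mainTheorem4 (n : ℕ) (hn : 2 < n) (s : Fin n → ℕ) (hs : IsTreeDegreeSequence s) :
    (treesWithDegreeSequence s).Nonempty ∧
    (minOverTrees matchingNumber s = maxOverTrees matchingNumber s ↔
      annihilationNumber s = leafCount s ∨ annihilationNumber s = ⌈(n : ℚ) / 2⌉₊) ∧
    (minOverTrees graphNullity s = maxOverTrees graphNullity s ↔
      annihilationNumber s = leafCount s ∨ annihilationNumber s = ⌈(n : ℚ) / 2⌉₊) ∧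
    (minOverTrees SimpleGraph.indepNum s = maxOverTrees SimpleGraph.indepNum s ↔
      annihilationNumber s = leafCount s ∨ annihilationNumber s = ⌈(n : ℚ) / 2⌉₊) := by
  have hne : (treesWithDegreeSequence s).Nonempty :=
    let ⟨G, hG, _⟩ := exists_annihilationNumber_le_indepNum hn hs
    ⟨G, hG⟩
  have hpar := fun G (hG : G ∈ treesWithDegreeSequence s) => (hs.isTree hG).parameters_eq
  rw [minOverTrees_eq_maxOverTrees_iff _ hne, minOverTrees_eq_maxOverTrees_iff _ hne,
    minOverTrees_eq_maxOverTrees_iff _ hne, ← indepNum_constant_iff hn hs]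
  refine ⟨hne, ?_, ?_, Iff.rfl⟩ <;>
    refine forall₂_congr fun G hG => forall₂_congr fun H hH => ?_ <;>
    have := hpar G hG <;>
    have := hpar H hH <;>
    omega
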